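/- Groups act on the right. Let a group $G$ act on a set $X$ (a $G$-set; $X$ may be empty). A mean on $X$ is a function $m\colon\mathfrak P(X)\to[0,1]$ on the subsets of $X$ with $m(X)=1$ and $m(A\sqcup B)=m(A)+m(B)$ for all disjoint $A,B\subseteq X$. The $G$-set $X$ is amenable if there is a mean $m$ on $X$ with $m(Ag)=m(A)$ for all $g\in G$ and $A\subseteq X$ (so the empty set is not amenable); a group $H$ is amenable if every non-empty $H$-set is amenable. A $G$-wobble is a map $\phi\colon Y\to Z$ between subsets $Y,Z\subseteq X$ for which there are a finite decomposition $Y=Y_1\sqcup\dots\sqcup Y_n$ and elements $g_1,\dots,g_n\in G$ with $\phi(y)=yg_i$ whenever $y\in Y_i$. A group $H$ acts on $X$ by bijective $G$-wobbles if every $h\in H$ acts on $X$ as a bijective $G$-wobble $X\to X$; an action of $H$ on $X$ is free if $xh=x$ for some $x\in X$ implies $h=1$. Theorem (Whyte). Let $X$ be a $G$-set. The following are equivalent: (1) $X$ is not amenable; (2) there is a free action of the free group $F_2$ of rank $2$ on $X$ by bijective $G$-wobbles; (3) there is a free action of a non-amenable group on $X$ by bijective $G$-wobbles. -/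

import Mathlib

universe u v w

open MulOpposite

/-! Groups act on the right.  A right action of `G` on `X` is, as usual in Mathlib, an action
of `Gᵐᵒᵖ` on `X`; the point `x g` is `op g • x`. -/

/-- A mean on `X`: a finitely additive probability defined on all subsets of `X`. -/
structure SetMean (X : Type v) where
  toFun : Set X → ℝ
  mem_Icc : ∀ A, toFun A ∈ Set.Icc (0 : ℝ) 1
  univ_eq_one : toFun Set.univ = 1
  union_eq_add : ∀ A B, Disjoint A B → toFun (A ∪ B) = toFun A + toFun B

/-- The right `G`-set `X` is amenable: there is a mean `m` on `X` with `m (A g) = m A` for all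
`g ∈ G` and `A ⊆ X`. (The empty set is not amenable.) -/
def IsAmenableSet (G : Type u) (X : Type v) [Group G] [MulAction Gᵐᵒᵖ X] : Prop :=
  ∃ m : SetMean X, ∀ (g : G) (A : Set X), m.toFun ((fun x : X => op g • x) '' A) = m.toFun A

/-- The group `G` is amenable: every non-empty right `G`-set is amenable. -/
def IsAmenableGroup (G : Type u) [Group G] : Prop :=
  ∀ (X : Type u) [MulAction Gᵐᵒᵖ X], Nonempty X → IsAmenableSet G X

/-- The universe of the `G`-sets in the definition of an amenable group is no restriction. -/
theorem IsAmenableGroup.isAmenableSet {G : Type u} [Group G] (hG : IsAmenableGroup G)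
    (X : Type v) [MulAction Gᵐᵒᵖ X] (hX : Nonempty X) : IsAmenableSet G X := by
  obtain ⟨x⟩ := hX
  obtain ⟨m, hm⟩ := hG G ⟨1⟩
  refine ⟨⟨fun A => m.toFun ((fun g : G => op g • x) ⁻¹' A), fun A => m.mem_Icc _, ?_, ?_⟩, ?_⟩
  · simpa using m.univ_eq_one
  · intro A B h
    rw [Set.preimage_union]
    exact m.union_eq_add _ _ (h.preimage _)
  · intro g A
    show m.toFun _ = m.toFun _
    rw [← hm g ((fun g : G => op g • x) ⁻¹' A)]
    congr 1
    ext k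
    simp only [Set.mem_preimage, Set.mem_image]
    constructor
    · rintro ⟨y, hy, hyk⟩
      refine ⟨k * g⁻¹, ?_, by simp⟩
      have : op (k * g⁻¹) • x = y := by
        rw [op_mul, mul_smul, ← hyk, op_inv, inv_smul_smul]
      rwa [this]
    · rintro ⟨l, hl, rfl⟩
      exact ⟨_, hl, by simp [mul_smul]⟩

/-- The restriction of `φ` to `Y` is a `G`-wobble `Y → Z`, for subsets `Y, Z` of the right
`G`-set `X`: it maps `Y` to `Z`, and there are a decomposition of `Y` into finitely many disjoint
pieces `P i` and elements `g i ∈ G` with `φ y = y (g i)` for all `y ∈ P i`. -/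
def IsWobble (G : Type u) {X : Type v} [Group G] [MulAction Gᵐᵒᵖ X]
    (φ : X → X) (Y Z : Set X) : Prop :=
  Set.MapsTo φ Y Z ∧
    ∃ (n : ℕ) (P : Fin n → Set X) (g : Fin n → G),
      (⋃ i, P i) = Y ∧ Pairwise (fun i j => Disjoint (P i) (P j)) ∧
        ∀ i, ∀ y ∈ P i, φ y = op (g i) • y

/-- The group `H` has a free right action on the right `G`-set `X` in which every element of
`H` acts by a bijective `G`-wobble `X → X`. -/
def ActsFreelyByWobbles (G : Type u) (H : Type w) (X : Type v) [Group G] [Group H]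
    [MulAction Gᵐᵒᵖ X] : Prop :=
  ∃ _ : MulAction Hᵐᵒᵖ X,
    (∀ (h : H) (x : X), op h • x = x → h = 1) ∧
      ∀ h : H, Function.Bijective (fun x : X => op h • x) ∧
        IsWobble G (fun x : X => op h • x) Set.univ Set.univ

/-! The substance is (1) ⇒ (2). Without Følner sets, finite sets expand by any factor, so Hall's
theorem packs finitely many copies of `X` into `X` with bounded displacement. By Schröder–Bernstein,
every surjection onto `X` with fibres of bounded size is then at bounded distance from a bijection
(`exists_equiv_isClose`).

This is used twice. Applied to `X × K → X`, with `K` the four letters of `F₂`, it gives every point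
four labelled children. After relabelling, every upward path meets a fixed label (`exists_forest`).
Cutting the edges with that label leaves rooted trees with three children per vertex. A letter may
be prefixed to a nonempty reduced word in three ways, so reduced words describe these trees, up to
the choice of their last letter. Thus (roots) × `F₂` maps onto `X` with fibres of bounded size,
multiplication by a letter moving at most one edge. The second application makes this map bijective,
and `F₂` acts by translations.

For (3) ⇒ (1), an invariant mean is invariant under bijective wobbles, and freeness gives an
equivariant map from `X` to any non-empty `H`-set, along which the mean is pushed. For (2) ⇒ (3),
two permutations of the natural numbers rule out an invariant mean. -/

/-! ### Bounded distance between maps. -/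

section Closeness

open scoped Pointwise

/-- Two maps into the right `G`-set `X` are close if finitely many elements of `G` suffice to move
every value of the first one to the corresponding value of the second one. -/
def IsClose (G : Type u) {X : Type v} [Group G] [MulAction Gᵐᵒᵖ X] {α : Type w}
    (f g : α → X) : Prop :=
  ∃ S : Set Gᵐᵒᵖ, S.Finite ∧ ∀ a, ∃ s ∈ S, g a = s • f a

variable {G : Type u} {X : Type v} [Group G] [MulAction Gᵐᵒᵖ X] {α β : Type*}

theorem IsClose.refl (f : α → X) : IsClose G f f :=
  ⟨{1}, Set.finite_singleton 1, fun _ => ⟨1, rfl, (one_smul _ _).symm⟩⟩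

theorem IsClose.symm {f g : α → X} (h : IsClose G f g) : IsClose G g f := by
  obtain ⟨S, hS, h⟩ := h
  refine ⟨S⁻¹, hS.inv, fun a => ?_⟩
  obtain ⟨s, hs, e⟩ := h a
  exact ⟨s⁻¹, Set.inv_mem_inv.2 hs, by rw [e, inv_smul_smul]⟩

theorem IsClose.trans {f g k : α → X} (h : IsClose G f g) (h' : IsClose G g k) :
    IsClose G f k := by
  obtain ⟨S, hS, h⟩ := h
  obtain ⟨T, hT, h'⟩ := h'
  refine ⟨T * S, hT.mul hS, fun a => ?_⟩
  obtain ⟨s, hs, e⟩ := h a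
  obtain ⟨t, ht, e'⟩ := h' a
  exact ⟨t * s, Set.mul_mem_mul ht hs, by rw [e', e, mul_smul]⟩

theorem IsClose.comp {f g : α → X} (h : IsClose G f g) (k : β → α) :
    IsClose G (f ∘ k) (g ∘ k) := by
  obtain ⟨S, hS, h⟩ := h
  exact ⟨S, hS, fun b => h (k b)⟩

/-- A pair of maps that agrees at every argument with one of two close pairs is close. -/
theorem IsClose.of_or {f g f₁ g₁ f₂ g₂ : α → X} (h₁ : IsClose G f₁ g₁) (h₂ : IsClose G f₂ g₂)
    (h : ∀ a, (f a = f₁ a ∧ g a = g₁ a) ∨ (f a = f₂ a ∧ g a = g₂ a)) : IsClose G f g := by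
  obtain ⟨S, hS, h₁⟩ := h₁
  obtain ⟨T, hT, h₂⟩ := h₂
  refine ⟨S ∪ T, hS.union hT, fun a => ?_⟩
  rcases h a with ⟨e, e'⟩ | ⟨e, e'⟩
  · obtain ⟨s, hs, hs'⟩ := h₁ a
    exact ⟨s, Or.inl hs, by rw [e, e', hs']⟩
  · obtain ⟨s, hs, hs'⟩ := h₂ a
    exact ⟨s, Or.inr hs, by rw [e, e', hs']⟩

/-- A map close to the identity is a wobble. -/
theorem IsClose.isWobble {φ : X → X} (h : IsClose G id φ) :
    IsWobble G φ Set.univ Set.univ := by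
  obtain ⟨S, hS, h⟩ := h
  choose s hs e using h
  have : Finite S := hS
  obtain ⟨n, ⟨q⟩⟩ := Finite.exists_equiv_fin S
  refine ⟨Set.mapsTo_univ _ _, n, fun i => {x | q ⟨s x, hs x⟩ = i},
    fun i => unop (q.symm i : Gᵐᵒᵖ), ?_, ?_, ?_⟩
  · ext x
    simp
  · intro i j hij
    refine Set.disjoint_left.2 fun x hx hx' => hij ?_
    exact Eq.trans (Eq.symm hx) hx'
  · rintro i x rfl
    simpa using e x

end Closeness

/-! ### Means and their invariance under wobbles. -/

namespace SetMean

variable {X : Type v} (m : SetMean X)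

theorem empty : m.toFun ∅ = 0 := by
  have := m.union_eq_add ∅ ∅ (Set.disjoint_empty _)
  rw [Set.union_empty] at this
  linarith

theorem compl (A : Set X) : m.toFun Aᶜ = 1 - m.toFun A := by
  have := m.union_eq_add A Aᶜ disjoint_compl_right
  rw [Set.union_compl_self, m.univ_eq_one] at this
  linarith

theorem iUnion {n : ℕ} (P : Fin n → Set X) (hP : Pairwise fun i j => Disjoint (P i) (P j)) :
    m.toFun (⋃ i, P i) = ∑ i, m.toFun (P i) := by
  classical
  have key : ∀ s : Finset (Fin n), m.toFun (⋃ i ∈ s, P i) = ∑ i ∈ s, m.toFun (P i) := by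
    intro s
    induction s using Finset.induction_on with
    | empty => simpa using m.empty
    | insert a s ha ih =>
      rw [Finset.sum_insert ha, Finset.set_biUnion_insert, m.union_eq_add, ih]
      refine Set.disjoint_iUnion₂_right.2 fun i hi => hP ?_
      rintro rfl
      exact ha hi
  simpa using key Finset.univ

/-- The image of a mean under a map. -/
def map {Y : Type w} (f : X → Y) : SetMean Y where
  toFun A := m.toFun (f ⁻¹' A)
  mem_Icc A := m.mem_Icc _
  univ_eq_one := by simpa using m.univ_eq_one
  union_eq_add A B h := by
    rw [Set.preimage_union]
    exact m.union_eq_add _ _ (h.preimage _)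

end SetMean

/-- A mean that is invariant under `G` is invariant under injective `G`-wobbles. -/
theorem IsWobble.mean_image {G : Type u} {X : Type v} [Group G] [MulAction Gᵐᵒᵖ X]
    {m : SetMean X}
    (hm : ∀ (g : G) (A : Set X), m.toFun ((fun x : X => op g • x) '' A) = m.toFun A)
    {φ : X → X} (hφ : IsWobble G φ Set.univ Set.univ) (hinj : Function.Injective φ) (A : Set X) :
    m.toFun (φ '' A) = m.toFun A := by
  obtain ⟨-, n, P, g, hP, hd, h⟩ := hφ
  have hA : A = ⋃ i, A ∩ P i := by rw [← Set.inter_iUnion, hP, Set.inter_univ]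
  have hdA : Pairwise fun i j => Disjoint (A ∩ P i) (A ∩ P j) := fun i j hij =>
    (hd hij).mono Set.inter_subset_right Set.inter_subset_right
  conv_lhs => rw [hA, Set.image_iUnion]
  conv_rhs => rw [hA]
  rw [m.iUnion _ hdA, m.iUnion _ fun i j hij => Set.disjoint_image_of_injective hinj (hdA hij)]
  refine Finset.sum_congr rfl fun i _ => ?_
  rw [← hm (g i) (A ∩ P i)]
  exact congrArg _ (Set.image_congr fun x hx => h i x hx.2)

/-! ### Følner sets and expansion. -/

section Folner

open scoped Pointwise
open Filter Topology

/-- A right `G`-set with Følner sets, that is, with finite non-empty sets that are almost invariant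
under any finite set of group elements, is amenable. -/
theorem isAmenableSet_of_folner {G : Type u} {X : Type v} [Group G] [MulAction Gᵐᵒᵖ X]
    [DecidableEq X]
    (h : ∀ (S : Finset Gᵐᵒᵖ) (n : ℕ), ∃ F : Finset X, F.Nonempty ∧
      ((S • F ∪ F).card : ℝ) ≤ (1 + 1 / (n + 1)) * F.card) : IsAmenableSet G X := by
  classical
  choose F hF hc using h
  let ι := Finset Gᵐᵒᵖ × ℕ
  let f (A : Set X) (i : ι) : ℝ := ((F i.1 i.2).filter (· ∈ A)).card / (F i.1 i.2).card
  have hpos : ∀ i : ι, (0 : ℝ) < (F i.1 i.2).card := fun i => by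
    exact_mod_cast (hF i.1 i.2).card_pos
  have hf : ∀ A i, f A i ∈ Set.Icc (0 : ℝ) 1 := fun A i => by
    refine ⟨by positivity, ?_⟩
    rw [div_le_one (hpos i)]
    exact_mod_cast Finset.card_filter_le _ _
  -- An ultrafilter makes the densities of all subsets converge at once. Refining `atTop` keeps what
  -- holds for all large finite sets and small errors.
  let U : Ultrafilter ι := Ultrafilter.of atTop
  have hU : (U : Filter ι) ≤ atTop := Ultrafilter.of_le atTop
  have hlim : ∀ A, ∃ x ∈ Set.Icc (0 : ℝ) 1, Tendsto (f A) U (𝓝 x) := fun A =>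
    isCompact_Icc.ultrafilter_le_nhds (U.map (f A))
      (le_principal_iff.2 (mem_map.2 (univ_mem' (hf A))))
  choose m hm hlim using hlim
  have hadd : ∀ A B, Disjoint A B → m (A ∪ B) = m A + m B := by
    intro A B hAB
    refine tendsto_nhds_unique (hlim (A ∪ B)) (((hlim A).add (hlim B)).congr fun i => ?_)
    simp only [f]
    rw [← add_div]
    congr 1
    rw [← Nat.cast_add, ← Finset.card_union_of_disjoint]
    · congr 2
      ext x
      simp only [Finset.mem_union, Finset.mem_filter, Set.mem_union]
      tauto
    · rw [Finset.disjoint_filter]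
      exact fun x _ hx hx' => Set.disjoint_left.1 hAB hx hx'
  have huniv : m Set.univ = 1 := by
    refine tendsto_nhds_unique (hlim _) (tendsto_const_nhds.congr fun i => ?_)
    simp only [f, Set.mem_univ, Finset.filter_true]
    exact (div_self (hpos i).ne').symm
  have hle : ∀ (g : G) (A : Set X), m A ≤ m ((fun x : X => op g • x) '' A) := by
    intro g A
    set B := (fun x : X => op g • x) '' A with hB
    have h0 : Tendsto (fun i : ι => 1 / ((i.2 : ℝ) + 1)) U (𝓝 0) := by
      refine Tendsto.mono_left ?_ hU
      exact tendsto_one_div_add_atTop_nhds_zero_nat.comp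
        (by rw [← prod_atTop_atTop_eq]; exact tendsto_snd)
    have hlim' := (hlim B).add h0
    rw [add_zero] at hlim'
    refine le_of_tendsto_of_tendsto (hlim A) hlim' ?_
    have hev : ∀ᶠ i : ι in U, ({op g}, 0) ≤ i := hU (eventually_ge_atTop _)
    filter_upwards [hev] with i hi
    have hgi : op g ∈ i.1 := Finset.singleton_subset_iff.1 hi.1
    simp only [f]
    have hc := hc i.1 i.2
    set E := F i.1 i.2
    -- A translated point of `A` either stays in `E`, hence in `B`, or is one of the few that leave
    -- `E`.
    have hsub : (E.filter (· ∈ A)).image (fun x => op g • x) ⊆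
        E.filter (· ∈ B) ∪ ((i.1 • E ∪ E) \ E) := by
      intro y hy
      obtain ⟨x, hx, rfl⟩ := Finset.mem_image.1 hy
      rw [Finset.mem_filter] at hx
      by_cases hxE : op g • x ∈ E
      · exact Finset.mem_union_left _ (Finset.mem_filter.2 ⟨hxE, ⟨x, hx.2, rfl⟩⟩)
      · exact Finset.mem_union_right _ (Finset.mem_sdiff.2
          ⟨Finset.mem_union_left _ (Finset.smul_mem_smul hgi hx.1), hxE⟩)
    have hcard := (Finset.card_le_card hsub).trans (Finset.card_union_le _ _)
    rw [Finset.card_image_of_injective _ (MulAction.injective (op g))] at hcard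
    have h1 := Finset.card_sdiff_add_card_eq_card
      (Finset.subset_union_right : E ⊆ i.1 • E ∪ E)
    have hcard' : ((E.filter (· ∈ A)).card : ℝ) ≤
        (E.filter (· ∈ B)).card + ((i.1 • E ∪ E) \ E).card := by exact_mod_cast hcard
    have h1' : ((((i.1 • E ∪ E) \ E).card : ℝ)) + E.card = (i.1 • E ∪ E).card := by
      exact_mod_cast h1
    have hp : (0 : ℝ) < E.card := hpos i
    rw [div_add' _ _ _ hp.ne', div_le_div_iff_of_pos_right hp]
    linarith
  refine ⟨⟨m, hm, huniv, hadd⟩, fun g A => le_antisymm ?_ (hle g A)⟩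
  refine (hle g⁻¹ _).trans_eq ?_
  congr 1
  rw [Set.image_image]
  simp

/-- In a non-amenable right `G`-set, finite sets expand by any given factor under some finite set
of group elements. -/
theorem exists_finset_expanding {G : Type u} {X : Type v} [Group G] [MulAction Gᵐᵒᵖ X]
    [DecidableEq X] [DecidableEq Gᵐᵒᵖ] (hX : ¬ IsAmenableSet G X) (k : ℕ) :
    ∃ S : Finset Gᵐᵒᵖ, ∀ F : Finset X, k * F.card ≤ (S • F).card := by
  have h := mt isAmenableSet_of_folner hX
  push Not at h
  obtain ⟨S, n, h⟩ := h
  -- Adjoining `1` makes the translates contain `F` itself; iterating then compounds the growth.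
  have hgrow : ∀ F : Finset X,
      (1 + 1 / ((n : ℝ) + 1)) * F.card ≤ ((insert 1 S • F).card : ℝ) := by
    intro F
    rcases F.eq_empty_or_nonempty with rfl | hF
    · simp
    · refine (h F hF).le.trans ?_
      norm_cast
      refine Finset.card_le_card (Finset.union_subset ?_ ?_)
      · exact Finset.smul_subset_smul_right (Finset.subset_insert _ _)
      · intro x hx
        simpa using Finset.smul_mem_smul (Finset.mem_insert_self 1 S) hx
  have hpow : ∀ (j : ℕ) (F : Finset X),
      (1 + 1 / ((n : ℝ) + 1)) ^ j * F.card ≤ (((insert 1 S) ^ j • F).card : ℝ) := by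
    intro j
    induction j with
    | zero => intro F; simp
    | succ j ih =>
      intro F
      rw [pow_succ', pow_succ', mul_smul, mul_assoc]
      exact (mul_le_mul_of_nonneg_left (ih F) (by positivity)).trans (hgrow _)
  obtain ⟨j, hj⟩ := pow_unbounded_of_one_lt (k : ℝ)
    (show (1 : ℝ) < 1 + 1 / ((n : ℝ) + 1) by simp; positivity)
  refine ⟨(insert 1 S) ^ j, fun F => ?_⟩
  have := (mul_le_mul_of_nonneg_right hj.le (Nat.cast_nonneg F.card)).trans (hpow j F)
  exact_mod_cast this

end Folner

/-! ### Hall matching and Schröder–Bernstein. -/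

section Hall

open scoped Pointwise

variable {G : Type u} {X : Type v} [Group G] [MulAction Gᵐᵒᵖ X]

/-- Finitely many copies of a non-amenable right `G`-set embed in it within bounded distance. -/
theorem exists_injective_isClose_fst (hX : ¬ IsAmenableSet G X) (K : Type w) [Fintype K] :
    ∃ J : X × K → X, Function.Injective J ∧ IsClose G Prod.fst J := by
  classical
  obtain ⟨S, hS⟩ := exists_finset_expanding hX (Fintype.card K)
  obtain ⟨J, hJ, hmem⟩ := (Finset.all_card_le_biUnion_card_iff_exists_injective
    (fun p : X × K => S • ({p.1} : Finset X))).1 fun A => by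
      have h1 : A ⊆ A.image Prod.fst ×ˢ Finset.univ := fun p hp =>
        Finset.mem_product.2 ⟨Finset.mem_image_of_mem _ hp, Finset.mem_univ _⟩
      have h2 := Finset.card_le_card h1
      rw [Finset.card_product, Finset.card_univ, mul_comm] at h2
      refine (h2.trans (hS _)).trans (Finset.card_le_card fun y hy => ?_)
      obtain ⟨s, hs, x, hx, rfl⟩ := Finset.mem_smul.1 hy
      obtain ⟨p, hp, rfl⟩ := Finset.mem_image.1 hx
      exact Finset.mem_biUnion.2
        ⟨p, hp, Finset.smul_mem_smul hs (Finset.mem_singleton_self _)⟩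
  refine ⟨J, hJ, S, S.finite_toSet, fun p => ?_⟩
  obtain ⟨s, hs, x, hx, e⟩ := Finset.mem_smul.1 (hmem p)
  rw [Finset.mem_singleton] at hx
  exact ⟨s, hs, by rw [← e, hx]⟩

/-- A set that lies over a non-amenable right `G`-set `X`, with all fibres non-empty and of bounded
size, is in bijection with `X` within bounded distance. -/
theorem exists_equiv_isClose (hX : ¬ IsAmenableSet G X) {Y : Type*} (π : Y → X)
    (hπ : Function.Surjective π) {K : Type w} [Fintype K] (o : Y → K)
    (ho : Function.Injective fun y => (π y, o y)) :
    ∃ e : Y ≃ X, IsClose G π e := by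
  obtain ⟨J, hJ, hc⟩ := exists_injective_isClose_fst hX K
  -- The relation records that each value of the bijection comes from `J` or from `π`; both have
  -- bounded displacement.
  obtain ⟨f, hf, h⟩ := Function.Embedding.schroeder_bernstein_of_rel
    (hJ.comp ho) (Function.injective_surjInv hπ)
    (fun y x => x = J (π y, o y) ∨ x = π y) (fun y => Or.inl rfl)
    (fun x => Or.inr (Function.surjInv_eq hπ x).symm)
  exact ⟨Equiv.ofBijective f hf, (hc.comp fun y => (π y, o y)).of_or (IsClose.refl π)
    fun y => (h y).imp (fun h => ⟨rfl, h⟩) fun h => ⟨rfl, h⟩⟩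

end Hall

/-! ### Forests and reduced words. -/

section Tree

open Function

/-- A surjective self-map has a section that reverses a step of every forward orbit. -/
theorem exists_section_reversing_orbits {X : Type v} (p : X → X) (hp : Surjective p) :
    ∃ σ : X → X, (∀ v, p (σ v) = v) ∧ ∀ x, ∃ n, σ (p (p^[n] x)) = p^[n] x := by
  classical
  -- Far enough along, `p` is injective on the orbit: either the orbit has entered a cycle or it
  -- never repeats.
  have hgood : ∀ x, ∃ m, ∀ i j, p^[i + 1] (p^[m] x) = p^[j + 1] (p^[m] x) →
      p^[i] (p^[m] x) = p^[j] (p^[m] x) := by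
    intro x
    by_cases h : ∃ m, p^[m] x ∈ periodicPts p
    · obtain ⟨m, hm⟩ := h
      have hper : ∀ i, p^[i] (p^[m] x) ∈ periodicPts p := by
        intro i
        induction i with
        | zero => exact hm
        | succ i ih =>
          rw [iterate_succ_apply']
          exact (bijOn_periodicPts p).mapsTo ih
      refine ⟨m, fun i j hij => (bijOn_periodicPts p).injOn (hper i) (hper j) ?_⟩
      rwa [← iterate_succ_apply' p, ← iterate_succ_apply' p]
    · push Not at h
      have hlt : ∀ i j, i < j → p^[i] x ≠ p^[j] x := by
        intro i j hij e
        refine h i (mk_mem_periodicPts (n := j - i) (by omega) ?_)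
        rw [IsPeriodicPt, IsFixedPt, ← iterate_add_apply, Nat.sub_add_cancel hij.le, e]
      refine ⟨0, fun i j hij => ?_⟩
      rcases lt_trichotomy i j with hlt' | rfl | hlt'
      · exact (hlt _ _ (Nat.succ_lt_succ hlt') hij).elim
      · rfl
      · exact (hlt _ _ (Nat.succ_lt_succ hlt') hij.symm).elim
  -- Points are equivalent when their forward orbits meet. Each class gets one base orbit on which
  -- `p` is injective; `σ` reverses `p` along it, and every orbit of the class merges into it.
  let r : Setoid X :=
    { r := fun x y => ∃ m n, p^[m] x = p^[n] y
      iseqv :=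
        { refl := fun x => ⟨0, 0, rfl⟩
          symm := fun ⟨m, n, e⟩ => ⟨n, m, e.symm⟩
          trans := fun {x y z} ⟨m, n, e⟩ ⟨k, l, e'⟩ => ⟨k + m, n + l, by
            rw [iterate_add_apply, e, ← iterate_add_apply, add_comm, iterate_add_apply, e',
              ← iterate_add_apply]⟩ } }
  choose μ hμ using hgood
  let b (x : X) : X := p^[μ (Quotient.mk r x).out] (Quotient.mk r x).out
  have hbp : ∀ x n, b (p^[n] x) = b x := by
    intro x n
    have : Quotient.mk r (p^[n] x) = Quotient.mk r x := Quotient.sound ⟨0, n, rfl⟩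
    simp only [b, this]
  have hb : ∀ x, ∃ m n, p^[m] x = p^[n] (b x) := by
    intro x
    obtain ⟨m, n, e⟩ : r (Quotient.mk r x).out x := Quotient.mk_out x
    refine ⟨μ (Quotient.mk r x).out + n, m, ?_⟩
    rw [iterate_add_apply, ← e, ← iterate_add_apply, add_comm, iterate_add_apply]
  let σ (v : X) : X := if h : ∃ i, p^[i + 1] (b v) = v then p^[h.choose] (b v) else surjInv hp v
  refine ⟨σ, fun v => ?_, fun x => ?_⟩
  · by_cases h : ∃ i, p^[i + 1] (b v) = v
    · simp only [σ, dif_pos h]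
      rw [← iterate_succ_apply' p]
      exact h.choose_spec
    · simp only [σ, dif_neg h]
      exact surjInv_eq hp v
  · obtain ⟨m, n, e⟩ := hb x
    refine ⟨m, ?_⟩
    have hbv : b (p (p^[m] x)) = b x := by rw [← iterate_succ_apply' p, hbp]
    have h : ∃ i, p^[i + 1] (b (p (p^[m] x))) = p (p^[m] x) :=
      ⟨n, by rw [hbv, iterate_succ_apply', e]⟩
    simp only [σ, dif_pos h]
    have h' := h.choose_spec
    generalize h.choose = i at h'
    rw [hbv] at h' ⊢
    rw [e, ← iterate_succ_apply' p] at h'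
    rw [e]
    exact hμ _ _ _ h'

variable {G : Type u} {X : Type v} [Group G] [MulAction Gᵐᵒᵖ X]

/-- A non-amenable right `G`-set is a forest in which, up to bounded distance, the children of a
vertex are labelled by `K`, and every upward path contains an edge with the label `k₀`. -/
theorem exists_forest (hX : ¬ IsAmenableSet G X) {K : Type w} [Fintype K] (k₀ : K) :
    ∃ Ψ : X × K ≃ X, IsClose G Prod.fst Ψ ∧
      ∀ x, ∃ n, (Ψ.symm ((fun y => (Ψ.symm y).1)^[n] x)).2 = k₀ := by
  classical
  obtain ⟨Ψ, hΨ⟩ := exists_equiv_isClose hX (Prod.fst : X × K → X) (fun x => ⟨(x, k₀), rfl⟩)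
    Prod.snd fun a b h => h
  obtain ⟨σ, hσ, hσ'⟩ := exists_section_reversing_orbits (fun y => (Ψ.symm y).1)
    fun x => ⟨Ψ (x, k₀), by simp⟩
  -- Swapping labels among the children of `x` gives the child `σ x` the label `k₀` and changes no
  -- parent.
  let τ : X × K ≃ X × K :=
    Equiv.prodShear (Equiv.refl X) fun x => Equiv.swap (Ψ.symm (σ x)).2 k₀
  have hτ : ∀ y, ((τ.trans Ψ).symm y).1 = (Ψ.symm y).1 := fun y => rfl
  refine ⟨τ.trans Ψ, hΨ.comp τ, fun x => ?_⟩
  obtain ⟨n, hn⟩ := hσ' x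
  refine ⟨n, ?_⟩
  simp only [hτ]
  generalize (fun y => (Ψ.symm y).1)^[n] x = y at hn
  show (Equiv.swap (Ψ.symm (σ (Ψ.symm y).1)).2 k₀).symm (Ψ.symm y).2 = k₀
  rw [hn, Equiv.symm_swap, Equiv.swap_apply_left]

/-- The position of a letter `t` of a word relative to the letter `u` that follows it. It is
`(0, true)` when `t` and `u` cancel. -/
def letterDiff (t u : Fin 2 × Bool) : Fin 2 × Bool := (t.1 - u.1, xor t.2 u.2)

theorem letterDiff_ne : ∀ t u : Fin 2 × Bool,
    letterDiff t u ≠ (0, true) ↔ (t.1 = u.1 → t.2 = u.2) := by decide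

theorem letterDiff_injective : ∀ t t' u : Fin 2 × Bool,
    letterDiff t u = letterDiff t' u → t = t' := by decide

theorem letterDiff_surjective : ∀ d u : Fin 2 × Bool, ∃ t, letterDiff t u = d := by decide

/-- The vertex to which a word leads from the root `r` of a tree whose edges are labelled by
letter differences. The last letter of the word does not matter. -/
def wordVertex (Ψ : X × (Fin 2 × Bool) → X) (r : X) : List (Fin 2 × Bool) → X
  | [] => r
  | [_] => r
  | t :: u :: l => Ψ (wordVertex Ψ r (u :: l), letterDiff t u)

section wordVertex

variable (Ψ : X × (Fin 2 × Bool) ≃ X)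

/-- Each vertex determines its parent and label. Reducedness excludes the label `(0, true)` below
the root, so the upward path reveals where the word ends. The label differences then recover the
letters from the last one backwards. -/
theorem wordVertex_injective {r r' : X} (hr : (Ψ.symm r).2 = (0, true))
    (hr' : (Ψ.symm r').2 = (0, true)) :
    ∀ l l' : List (Fin 2 × Bool), FreeGroup.IsReduced l → FreeGroup.IsReduced l' →
      wordVertex Ψ r l = wordVertex Ψ r' l' → l.getLast? = l'.getLast? → r = r' ∧ l = l'
  | [], [], _, _, h, _ => ⟨h, rfl⟩
  | [], [_], _, _, _, e => by simp at e
  | [_], [], _, _, _, e => by simp at e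
  | [_], [_], _, _, h, e => ⟨h, by simpa using e⟩
  | [], t :: u :: l, _, hl, h, _ => by
    rw [FreeGroup.isReduced_cons_cons, ← letterDiff_ne] at hl
    simp only [wordVertex] at h
    simp [h, hl.1] at hr
  | [_], t :: u :: l, _, hl, h, _ => by
    rw [FreeGroup.isReduced_cons_cons, ← letterDiff_ne] at hl
    simp only [wordVertex] at h
    simp [h, hl.1] at hr
  | t :: u :: l, [], hl, _, h, _ => by
    rw [FreeGroup.isReduced_cons_cons, ← letterDiff_ne] at hl
    simp only [wordVertex] at h
    simp [← h, hl.1] at hr'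
  | t :: u :: l, [_], hl, _, h, _ => by
    rw [FreeGroup.isReduced_cons_cons, ← letterDiff_ne] at hl
    simp only [wordVertex] at h
    simp [← h, hl.1] at hr'
  | t :: u :: l, t' :: u' :: l', hl, hl', h, e => by
    rw [FreeGroup.isReduced_cons_cons] at hl hl'
    simp only [wordVertex, EmbeddingLike.apply_eq_iff_eq, Prod.mk.injEq] at h
    rw [List.getLast?_cons_cons, List.getLast?_cons_cons] at e
    obtain ⟨h1, h2⟩ := wordVertex_injective hr hr' (u :: l) (u' :: l') hl.2 hl'.2 h.1 e
    rw [List.cons.injEq] at h2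
    obtain ⟨rfl, rfl⟩ := h2
    exact ⟨h1, by rw [letterDiff_injective _ _ _ h.2]⟩

/-- Climbing from `x` to the first vertex labelled `(0, true)` finds the root; the labels passed
prescribe the letters, once a last letter is chosen arbitrarily. -/
theorem exists_wordVertex_eq
    (h : ∀ x, ∃ n, (Ψ.symm ((fun y => (Ψ.symm y).1)^[n] x)).2 = (0, true)) (x : X) :
    ∃ r, (Ψ.symm r).2 = (0, true) ∧ ∃ t l, FreeGroup.IsReduced (t :: l) ∧
      wordVertex Ψ r (t :: l) = x := by
  obtain ⟨n, hn⟩ := h x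
  induction n generalizing x with
  | zero => exact ⟨x, hn, (0, true), [], FreeGroup.IsReduced.singleton, rfl⟩
  | succ n ih =>
    by_cases hx : (Ψ.symm x).2 = (0, true)
    · exact ⟨x, hx, (0, true), [], FreeGroup.IsReduced.singleton, rfl⟩
    · obtain ⟨r, hr, u, l, hl, e⟩ := ih _ hn
      obtain ⟨t, ht⟩ := letterDiff_surjective (Ψ.symm x).2 u
      refine ⟨r, hr, t, u :: l, ?_, ?_⟩
      · rw [FreeGroup.isReduced_cons_cons, ← letterDiff_ne, ht]
        exact ⟨hx, hl⟩
      · simp only [wordVertex, e, ht]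
        exact Ψ.apply_symm_apply x

theorem isClose_wordVertex_cons {Ψ : X × (Fin 2 × Bool) → X} (hΨ : IsClose G Prod.fst Ψ)
    {α : Type*} (r : α → X) (t : α → Fin 2 × Bool) (l : α → List (Fin 2 × Bool)) :
    IsClose G (fun a => wordVertex Ψ (r a) (l a)) fun a => wordVertex Ψ (r a) (t a :: l a) := by
  -- Prefixing a letter to the empty word does not move the vertex; otherwise it descends one edge.
  -- The default letter is never used.
  refine (IsClose.refl fun a => wordVertex Ψ (r a) (l a)).of_or
    (hΨ.comp fun a => (wordVertex Ψ (r a) (l a), letterDiff (t a) ((l a).headD (0, true))))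
    fun a => ?_
  simp only [Function.comp_apply, true_and]
  match l a with
  | [] => exact Or.inl rfl
  | u :: l => exact Or.inr rfl

end wordVertex

/-- Multiplication by a letter either adds a letter to a reduced word or removes one. -/
theorem FreeGroup.toWord_mk_singleton_mul {α : Type*} [DecidableEq α] (t : α × Bool)
    (g : FreeGroup α) : (FreeGroup.mk [t] * g).toWord = t :: g.toWord ∨
      ∃ s, g.toWord = s :: (FreeGroup.mk [t] * g).toWord := by
  rw [FreeGroup.toWord_mul, FreeGroup.toWord_mk, FreeGroup.reduce_singleton, List.singleton_append,
    FreeGroup.reduce.cons, FreeGroup.reduce_toWord]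
  rcases g.toWord with _ | ⟨s, l⟩
  · exact Or.inl rfl
  · dsimp only
    split_ifs
    · exact Or.inr ⟨s, rfl⟩
    · exact Or.inl rfl

/-- A non-amenable right `G`-set is, up to bounded distance, a disjoint union of copies of the
free group of rank two. -/
theorem exists_equiv_prod_freeGroup (hX : ¬ IsAmenableSet G X) :
    ∃ (R : Type v) (e : R × FreeGroup (Fin 2) ≃ X),
      ∀ h : FreeGroup (Fin 2), IsClose G e fun y => e (y.1, h * y.2) := by
  obtain ⟨Ψ, hΨ, hroot⟩ := exists_forest hX ((0, true) : Fin 2 × Bool)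
  let Y := {r : X // (Ψ.symm r).2 = (0, true)} × FreeGroup (Fin 2)
  let π (y : Y) : X := wordVertex Ψ y.1 y.2.toWord
  have hπ : Surjective π := fun x => by
    obtain ⟨r, hr, t, l, hl, e⟩ := exists_wordVertex_eq Ψ hroot x
    refine ⟨(⟨r, hr⟩, FreeGroup.mk (t :: l)), ?_⟩
    simp only [π, FreeGroup.toWord_mk]
    rwa [hl.reduce_eq]
  -- The last letter, if any, separates the points of a fibre of `π`, so fibres have at most five
  -- points.
  obtain ⟨e, he⟩ := exists_equiv_isClose hX π hπ (fun y => y.2.toWord.getLast?) (by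
    rintro ⟨⟨r, hr⟩, g⟩ ⟨⟨r', hr'⟩, g'⟩ h
    rw [Prod.mk.injEq] at h
    obtain ⟨rfl, h2⟩ := wordVertex_injective Ψ hr hr' _ _ FreeGroup.isReduced_toWord
      FreeGroup.isReduced_toWord h.1 h.2
    exact Prod.ext rfl (FreeGroup.toWord_injective h2))
  refine ⟨_, e, fun h => ?_⟩
  have hletter : ∀ t : Fin 2 × Bool, IsClose G e fun y : Y => e (y.1, FreeGroup.mk [t] * y.2) := by
    intro t
    -- Pass from `e` to `π`, move along at most one edge, and return to `e`. If a letter cancels,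
    -- the edge is traversed upwards.
    refine he.symm.trans (IsClose.trans ?_ (he.comp fun y : Y => (y.1, FreeGroup.mk [t] * y.2)))
    refine (isClose_wordVertex_cons hΨ (fun y : Y => (y.1 : X)) (fun _ => t)
      fun y => y.2.toWord).of_or (isClose_wordVertex_cons hΨ (fun y : Y => (y.1 : X))
      (fun y => y.2.toWord.headD (0, true)) fun y => (FreeGroup.mk [t] * y.2).toWord).symm
      fun y => ?_
    rcases FreeGroup.toWord_mk_singleton_mul t y.2 with h | ⟨s, h⟩
    · exact Or.inl ⟨rfl, congrArg (wordVertex Ψ (y.1 : X)) h⟩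
    · refine Or.inr ⟨congrArg (wordVertex Ψ (y.1 : X)) ?_, rfl⟩
      rw [h, List.headD_cons]
  induction h using FreeGroup.induction_on with
  | C1 => simpa using IsClose.refl e
  | of a => exact hletter (a, true)
  | inv_of a _ => exact hletter (a, false)
  | mul g h hg hh =>
    simp only [mul_assoc]
    exact hh.trans (hg.comp fun y : Y => (y.1, h * y.2))

end Tree

/-! ### Free actions and transport of means. -/

section FreeActions

/-- The right action of a group given by a homomorphism to permutations, acting by inverses. -/
@[reducible]
def rightActionOfPerm {H : Type u} [Group H] {Y : Type v} (ρ : H →* Equiv.Perm Y) :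
    MulAction Hᵐᵒᵖ Y where
  smul h y := ρ (unop h)⁻¹ y
  one_smul y := by
    change ρ (unop 1)⁻¹ y = y
    simp
  mul_smul h k y := by
    change ρ (unop (h * k))⁻¹ y = ρ (unop h)⁻¹ (ρ (unop k)⁻¹ y)
    simp

/-- A group with a free action on an amenable set by mean-preserving bijections is amenable. -/
theorem isAmenableGroup_of_free {H : Type w} [Group H] {X : Type v} [MulAction Hᵐᵒᵖ X]
    (hfree : ∀ (h : H) (x : X), op h • x = x → h = 1) (hX : IsAmenableSet H X) :
    IsAmenableGroup H := by
  intro Y _ ⟨y₀⟩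
  obtain ⟨m, hm⟩ := hX
  let base (x : X) : X := (Quotient.mk (MulAction.orbitRel Hᵐᵒᵖ X) x).out
  have hbase : ∀ x, ∃ h : H, op h • base x = x := by
    intro x
    obtain ⟨h, e⟩ := (MulAction.orbitRel Hᵐᵒᵖ X).symm
      (Quotient.mk_out (s := MulAction.orbitRel Hᵐᵒᵖ X) x)
    exact ⟨unop h, e⟩
  choose c hc using hbase
  -- Freeness makes the orbit coordinate `c` unique, hence equivariant.
  have hcg : ∀ (g : H) (x : X), c (op g • x) = c x * g := by
    intro g x
    have hb : base (op g • x) = base x := by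
      have : Quotient.mk (MulAction.orbitRel Hᵐᵒᵖ X) (op g • x) = Quotient.mk _ x :=
        Quotient.sound ⟨op g, rfl⟩
      simp only [base, this]
    have h1 := hc (op g • x)
    rw [hb] at h1
    refine mul_inv_eq_one.1 (hfree _ (base x) ?_)
    rw [op_mul, mul_smul, h1, op_inv, inv_smul_eq_iff, op_mul, mul_smul, hc]
  refine ⟨m.map fun x => op (c x) • y₀, fun g A => ?_⟩
  show m.toFun _ = m.toFun _
  rw [← hm g ((fun x : X => op (c x) • y₀) ⁻¹' A)]
  congr 1
  ext x
  simp only [Set.mem_preimage, Set.mem_image]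
  constructor
  · rintro ⟨y, hy, e⟩
    refine ⟨op g⁻¹ • x, ?_, by simp⟩
    rw [hcg, op_mul, mul_smul, ← e, op_inv, inv_smul_smul]
    exact hy
  · rintro ⟨x, hx, rfl⟩
    exact ⟨_, hx, by rw [hcg, op_mul, mul_smul]⟩

theorem not_isAmenableSet_of_actsFreelyByWobbles {G : Type u} {X : Type v} [Group G]
    [MulAction Gᵐᵒᵖ X] {H : Type w} [Group H] (hH : ¬ IsAmenableGroup H)
    (h : ActsFreelyByWobbles G H X) : ¬ IsAmenableSet G X := by
  rintro ⟨m, hm⟩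
  obtain ⟨_, hfree, hw⟩ := h
  exact hH (isAmenableGroup_of_free hfree
    ⟨m, fun g A => (hw g).2.mean_image hm (hw g).1.injective A⟩)

theorem actsFreelyByWobbles_freeGroup {G : Type u} {X : Type v} [Group G] [MulAction Gᵐᵒᵖ X]
    (hX : ¬ IsAmenableSet G X) : ActsFreelyByWobbles G (FreeGroup (Fin 2)) X := by
  obtain ⟨R, e, he⟩ := exists_equiv_prod_freeGroup hX
  let ρ : FreeGroup (Fin 2) →* Equiv.Perm X :=
    { toFun := fun h => (e.symm.trans (Equiv.prodCongr (Equiv.refl R) (Equiv.mulLeft h))).trans e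
      map_one' := by ext x; simp
      map_mul' := fun g h => by ext x; simp [Prod.map] }
  refine ⟨rightActionOfPerm ρ, fun h x hx => ?_, fun h => ⟨(ρ h⁻¹).bijective, ?_⟩⟩
  · have hx' : e ((e.symm x).1, h⁻¹ * (e.symm x).2) = x := hx
    rw [← Equiv.eq_symm_apply] at hx'
    simpa using congrArg Prod.snd hx'
  · have := (he h⁻¹).comp e.symm
    rw [Equiv.self_comp_symm] at this
    exact this.isWobble

theorem ActsFreelyByWobbles.of_mulEquiv {G : Type u} {X : Type v} [Group G] [MulAction Gᵐᵒᵖ X]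
    {H H' : Type*} [Group H] [Group H'] (h : ActsFreelyByWobbles G H X) (e : H' ≃* H) :
    ActsFreelyByWobbles G H' X := by
  obtain ⟨_, hfree, hw⟩ := h
  refine ⟨MulAction.compHom X (MulEquiv.op e).toMonoidHom, fun h x hx => ?_, fun h => hw (e h)⟩
  exact (MulEquiv.map_eq_one_iff e).1 (hfree (e h) x hx)

end FreeActions

/-! ### Non-amenability of the free group. -/

section FreeGroupNotAmenable

/-- Any two infinite and co-infinite subsets of a countable set are related by a permutation. -/
theorem exists_perm_image_eq {Y : Type*} [Countable Y] {S T : Set Y} (hS : S.Infinite)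
    (hS' : Sᶜ.Infinite) (hT : T.Infinite) (hT' : Tᶜ.Infinite) :
    ∃ f : Equiv.Perm Y, f '' S = T := by
  classical
  have := hS.to_subtype
  have := hS'.to_subtype
  have := hT.to_subtype
  have := hT'.to_subtype
  obtain ⟨_⟩ := nonempty_denumerable S
  obtain ⟨_⟩ := nonempty_denumerable (Sᶜ : Set Y)
  obtain ⟨_⟩ := nonempty_denumerable T
  obtain ⟨_⟩ := nonempty_denumerable (Tᶜ : Set Y)
  let f : Equiv.Perm Y := ((Equiv.Set.sumCompl S).symm.trans
    (Equiv.sumCongr (Denumerable.equiv₂ S T)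
      (Denumerable.equiv₂ (Sᶜ : Set Y) (Tᶜ : Set Y)))).trans (Equiv.Set.sumCompl T)
  have hf : ∀ y, f y ∈ T ↔ y ∈ S := by
    intro y
    by_cases hy : y ∈ S
    · simp [f, Equiv.Set.sumCompl_symm_apply_of_mem hy, hy]
    · simp only [f, Equiv.trans_apply, Equiv.Set.sumCompl_symm_apply_of_notMem hy, hy, iff_false,
        Equiv.sumCongr_apply, Sum.map_inr, Equiv.Set.sumCompl_apply_inr]
      exact Subtype.coe_prop (Denumerable.equiv₂ (Sᶜ : Set Y) (Tᶜ : Set Y) ⟨y, hy⟩)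
  refine ⟨f, Set.ext fun y => ⟨?_, fun hy => ⟨f.symm y, ?_, f.apply_symm_apply y⟩⟩⟩
  · rintro ⟨x, hx, rfl⟩
    exact (hf x).2 hx
  · rwa [← hf, f.apply_symm_apply]

/-- Let the generators carry the complement of `A 1` onto `A 0` and that of `A 3` onto `A 2`.
Invariance gives `A 0 ∪ A 1` and `A 2 ∪ A 3` mean `1` each, although they are disjoint. -/
theorem not_isAmenableGroup_of_mulEquiv_freeGroup {H : Type w} [Group H]
    (e : H ≃* FreeGroup (Fin 2)) : ¬ IsAmenableGroup H := by
  intro hH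
  let A (i : ℕ) : Set (ULift.{w} ℕ) := {n | n.down % 4 = i}
  have hA : ∀ i < 4, (A i).Infinite := fun i hi =>
    Set.infinite_of_injective_forall_mem (f := fun n : ℕ => ULift.up (4 * n + i))
      (fun m n h => by simpa using h) fun n => by simp [A]; omega
  have hA' : ∀ i j, j < 4 → i ≠ j → ((A i)ᶜ).Infinite := fun i j hj hij =>
    (hA j hj).mono fun n hn hn' => hij (Eq.trans (Eq.symm hn') hn)
  obtain ⟨a, ha⟩ := exists_perm_image_eq (hA' 1 0 (by decide) (by decide))
    (by rw [compl_compl]; exact hA 1 (by decide)) (hA 0 (by decide))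
    (hA' 0 1 (by decide) (by decide))
  obtain ⟨b, hb⟩ := exists_perm_image_eq (hA' 3 0 (by decide) (by decide))
    (by rw [compl_compl]; exact hA 3 (by decide)) (hA 2 (by decide))
    (hA' 2 1 (by decide) (by decide))
  let φ : FreeGroup (Fin 2) →* Equiv.Perm (ULift.{w} ℕ) := FreeGroup.lift ![a, b]
  let _ : MulAction Hᵐᵒᵖ (ULift.{w} ℕ) := rightActionOfPerm (φ.comp e.toMonoidHom)
  obtain ⟨m, hm⟩ := hH (ULift.{w} ℕ) ⟨⟨0⟩⟩
  have hinv : ∀ g (B : Set (ULift.{w} ℕ)), m.toFun (φ g '' B) = m.toFun B := by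
    intro g B
    have h := hm (e.symm g)⁻¹ B
    have hfun : (fun x : ULift.{w} ℕ => op (e.symm g)⁻¹ • x) = φ g := by
      funext x
      change φ (e ((e.symm g)⁻¹)⁻¹) x = φ g x
      simp
    rwa [hfun] at h
  have h1 : m.toFun (A 0) = 1 - m.toFun (A 1) := by
    have hφ : φ (FreeGroup.of 0) = a := by simp [φ]
    rw [← m.compl, ← ha, ← hinv (FreeGroup.of 0) (A 1)ᶜ, hφ]
  have h2 : m.toFun (A 2) = 1 - m.toFun (A 3) := by
    have hφ : φ (FreeGroup.of 1) = b := by simp [φ]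
    rw [← m.compl, ← hb, ← hinv (FreeGroup.of 1) (A 3)ᶜ, hφ]
  have hdisj : ∀ i j, i ≠ j → Disjoint (A i) (A j) := fun i j hij =>
    Set.disjoint_left.2 fun n hn hn' => hij (Eq.trans (Eq.symm hn) hn')
  have h3 := m.union_eq_add _ _ (hdisj 0 1 (by decide))
  have h4 := m.union_eq_add _ _ (hdisj 2 3 (by decide))
  have h5 := m.union_eq_add (A 0 ∪ A 1) (A 2 ∪ A 3) (by
    rw [Set.disjoint_union_left, Set.disjoint_union_right, Set.disjoint_union_right]
    exact ⟨⟨hdisj 0 2 (by decide), hdisj 0 3 (by decide)⟩,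
      hdisj 1 2 (by decide), hdisj 1 3 (by decide)⟩)
  have h6 := (m.mem_Icc (A 0 ∪ A 1 ∪ (A 2 ∪ A 3))).2
  linarith

end FreeGroupNotAmenable

theorem mainTheorem3 (G : Type u) (X : Type v) [Group G] [MulAction Gᵐᵒᵖ X] :
    List.TFAE [
      ¬ IsAmenableSet G X,
      ActsFreelyByWobbles G (FreeGroup (Fin 2)) X,
      ∃ (H : Type w) (_ : Group H), ¬ IsAmenableGroup H ∧ ActsFreelyByWobbles G H X] := by
  tfae_have 1 → 2 := actsFreelyByWobbles_freeGroup
  tfae_have 2 → 3 := fun h => ⟨ULift.{w} (FreeGroup (Fin 2)), inferInstance,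
    not_isAmenableGroup_of_mulEquiv_freeGroup MulEquiv.ulift, h.of_mulEquiv MulEquiv.ulift⟩
  tfae_have 3 → 1 := fun ⟨_, _, hH, h⟩ => not_isAmenableSet_of_actsFreelyByWobbles hH h
  tfae_finish
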